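/- Let $a,b$ be real numbers with $a^2+b^2=4$ and let $q$ be a complex number with $|q|<1$. For real $c$ and complex $z$ with $|z|<1$ put $$f_c(z)=\sum_{n=0}^{\infty}\frac{z^{n^2}}{\prod_{k=1}^{n}\left(1+cz^k+z^{2k}\right)},\qquad (x;z)_\infty=\prod_{n=0}^{\infty}(1-xz^n).$$ Then no denominator in the formula below vanishes (including those in the series), the series in it converge absolutely, the infinite products in it converge unconditionally, and $$\frac{b-a+2}{4}\,f_a(-q)+\frac{b+a+2}{4}\,f_{-a}(-q)-\frac b2\,f_b(q)=\frac{(q^4;q^4)_\infty}{(-q;q^2)_\infty}\prod_{n=1}^{\infty}\frac{1-bq^n+q^{2n}}{1+(a^2b^2-2)q^{4n}+q^{8n}}.$$ -/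

import Mathlib

/-- The `n`-th factor `1 - a q ^ n` (`n ≥ 0`) of the `q`-shifted factorial. -/
def qFactor (a q : ℂ) (n : ℕ) : ℂ := 1 - a * q ^ n

/-- The infinite `q`-shifted factorial `(a; q)_∞ = ∏_{n ≥ 0} (1 - a q ^ n)`. -/
noncomputable def qPochInf (a q : ℂ) : ℂ := ∏' n : ℕ, qFactor a q n

/-- The quadratic factor `1 + a q ^ k + q ^ (2 k)`. -/
def quadFactor (a : ℝ) (q : ℂ) (k : ℕ) : ℂ := 1 + (a : ℂ) * q ^ k + q ^ (2 * k)

/-- The `n`-th term `q ^ (n ^ 2) / ∏_{k = 1}^{n} (1 + a q ^ k + q ^ (2 k))` of `f_a(q)`. -/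
noncomputable def mockTerm (a : ℝ) (q : ℂ) (n : ℕ) : ℂ :=
  q ^ (n ^ 2) / ∏ k ∈ Finset.Icc 1 n, quadFactor a q k

/-- `f_a(q) = ∑_{n ≥ 0} q ^ (n ^ 2) / ∏_{k = 1}^{n} (1 + a q ^ k + q ^ (2 k))`. -/
noncomputable def mockF (a : ℝ) (q : ℂ) : ℂ := ∑' n : ℕ, mockTerm a q n

/-- The factor of index `n` of the product
`∏_{n ≥ 1} (1 - b q ^ n + q ^ (2 n)) / (1 + (a² b² - 2) q ^ (4 n) + q ^ (8 n))`. -/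
noncomputable def entryFactor (a b : ℝ) (q : ℂ) (n : ℕ) : ℂ :=
  (1 - (b : ℂ) * q ^ n + q ^ (2 * n)) /
    (1 + ((a : ℂ) ^ 2 * (b : ℂ) ^ 2 - 2) * q ^ (4 * n) + q ^ (8 * n))

open Filter Topology

/-! ### The infinite `q`-shifted factorial -/

/-! The condition a² + b² = 4 is parametrized by |y| = 1, with b = -(y + y⁻¹) and a = i(y - y⁻¹).
The quadratic factors of f_b(q), f_{-a}(-q), f_a(-q) then split as (1 - xqᵏ)(1 - x⁻¹qᵏ), with q
replaced by -q in the last two, for x = y, iy, -iy. Thus each series is `rankSum` divided by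
`rankDenom` (`mockF_eq_div`). With denominators cleared, the left side becomes `rankCombination`, a
function of y holomorphic on ℂ \ {0}. `rankSum` obeys a q-difference equation with a theta
inhomogeneity (`rankSum_mul`); in the combination these inhomogeneities cancel, and y ↦ qy
multiplies it by q (`rankCombination_mul`). Hence its quotient by y is invariant under y ↦ qy, so
constant by Liouville (`eq_apply_one_of_apply_mul_eq`). At y = 1 two of the three terms vanish and
Cauchy's identity `rankSum_one` evaluates the third. Product identities for q-factorials then give
the stated right side. -/

lemma summable_norm_geometric_mul {q : ℂ} (hq : ‖q‖ < 1) (x : ℂ) :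
    Summable fun n : ℕ => ‖-(x * q ^ n)‖ := by
  simpa [norm_mul, norm_pow] using
    (summable_geometric_of_lt_one (norm_nonneg q) hq).mul_left ‖x‖

lemma multipliable_qFactor {q : ℂ} (hq : ‖q‖ < 1) (x : ℂ) : Multipliable (qFactor x q) := by
  have h := multipliable_one_add_of_summable (summable_norm_geometric_mul hq x)
  exact h.congr fun n => by simp [qFactor, sub_eq_add_neg]

lemma qPochInf_ne_zero {q : ℂ} (hq : ‖q‖ < 1) {x : ℂ} (h : ∀ n, qFactor x q n ≠ 0) :
    qPochInf x q ≠ 0 := by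
  have := tprod_one_add_ne_zero_of_summable (f := fun n : ℕ => -(x * q ^ n))
    (fun n => by simpa [qFactor, sub_eq_add_neg] using h n) (summable_norm_geometric_mul hq x)
  simpa [qPochInf, qFactor, sub_eq_add_neg] using this

lemma qFactor_ne_zero_of_norm_lt_one {q x : ℂ} (hq : ‖q‖ < 1) (hx : ‖x‖ < 1) (n : ℕ) :
    qFactor x q n ≠ 0 := by
  intro h
  have h1 : x * q ^ n = 1 := (sub_eq_zero.mp h).symm
  have h2 : ‖x * q ^ n‖ < 1 := by
    rw [norm_mul, norm_pow]
    exact mul_lt_one_of_nonneg_of_lt_one_left (norm_nonneg _) hx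
      (pow_le_one₀ (norm_nonneg _) hq.le)
  simp [h1] at h2

lemma qPochInf_ne_zero_of_norm_lt_one {q x : ℂ} (hq : ‖q‖ < 1) (hx : ‖x‖ < 1) :
    qPochInf x q ≠ 0 :=
  qPochInf_ne_zero hq (qFactor_ne_zero_of_norm_lt_one hq hx)

lemma norm_qPochInf_le {q : ℂ} (hq : ‖q‖ < 1) (x : ℂ) :
    ‖qPochInf x q‖ ≤ Real.exp (‖x‖ * (1 - ‖q‖)⁻¹) := by
  have h := (multipliable_qFactor hq x).hasProd.norm
  refine le_of_tendsto h (Eventually.of_forall fun s => ?_)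
  have h1 := s.norm_prod_one_add_sub_one_le (fun n : ℕ => -(x * q ^ n))
  have h2 : ∑ n ∈ s, ‖-(x * q ^ n)‖ ≤ ‖x‖ * (1 - ‖q‖)⁻¹ := by
    refine ((summable_norm_geometric_mul hq x).sum_le_tsum s fun _ _ => norm_nonneg _).trans ?_
    simp [norm_pow, tsum_mul_left, tsum_geometric_of_lt_one (norm_nonneg q) hq]
  have h3 : ‖∏ n ∈ s, (1 + -(x * q ^ n))‖ ≤ Real.exp (∑ n ∈ s, ‖-(x * q ^ n)‖) := by
    have := norm_le_norm_add_norm_sub' (∏ n ∈ s, (1 + -(x * q ^ n))) 1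
    rw [norm_one] at this
    linarith
  have h4 : ∏ n ∈ s, qFactor x q n = ∏ n ∈ s, (1 + -(x * q ^ n)) := by
    simp [qFactor, sub_eq_add_neg]
  rw [← norm_prod, h4]
  exact h3.trans (Real.exp_le_exp.mpr h2)

lemma norm_qPochInf_le_of_norm_le {q : ℂ} (hq : ‖q‖ < 1) {x : ℂ} {A : ℝ} (hx : ‖x‖ ≤ A) :
    ‖qPochInf x q‖ ≤ Real.exp (A * (1 - ‖q‖)⁻¹) :=
  (norm_qPochInf_le hq x).trans <| Real.exp_le_exp.mpr <|
    mul_le_mul_of_nonneg_right hx (inv_nonneg.mpr (by linarith))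

lemma qPochInf_eq_mul {q : ℂ} (hq : ‖q‖ < 1) (x : ℂ) :
    qPochInf x q = (1 - x) * qPochInf (x * q) q := by
  have h : (fun n => qFactor x q (n + 1)) = qFactor (x * q) q := by
    funext n; simp only [qFactor]; ring
  rw [qPochInf, tprod_eq_zero_mul' (by rw [h]; exact multipliable_qFactor hq _), h]
  rw [show qFactor x q 0 = 1 - x by simp [qFactor], qPochInf]

lemma qPochInf_one {q : ℂ} (hq : ‖q‖ < 1) : qPochInf 1 q = 0 := by
  rw [qPochInf_eq_mul hq]; simp

lemma qPochInf_zero (q : ℂ) : qPochInf 0 q = 1 := by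
  simp [qPochInf, qFactor]

lemma qPochInf_eq_prod_mul {q : ℂ} (hq : ‖q‖ < 1) (x : ℂ) (n : ℕ) :
    qPochInf (x * q) q = (∏ k ∈ Finset.Icc 1 n, (1 - x * q ^ k)) * qPochInf (x * q ^ (n + 1)) q := by
  induction n with
  | zero => simp
  | succ n ih =>
    rw [Finset.prod_Icc_succ_top (by omega), ih, qPochInf_eq_mul hq (x * q ^ (n + 1))]
    rw [show x * q ^ (n + 1) * q = x * q ^ (n + 1 + 1) by ring]
    ring

/-- Pair the factors of equal index. Only r² survives, so one statement serves both bases q and -q.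
-/
lemma qPochInf_mul_neg {q r : ℂ} (hq : ‖q‖ < 1) (hr : r = q ∨ r = -q) (x : ℂ) :
    qPochInf x r * qPochInf (-x) r = qPochInf (x ^ 2) (q ^ 2) := by
  have hr' : ‖r‖ < 1 := by rcases hr with rfl | rfl <;> simpa using hq
  have h2 : r ^ 2 = q ^ 2 := by rcases hr with rfl | rfl <;> ring
  rw [qPochInf, qPochInf,
    ← (multipliable_qFactor hr' _).tprod_mul (multipliable_qFactor hr' _), qPochInf, ← h2]
  congr 1
  funext n
  simp only [qFactor]
  ring

lemma qPochInf_even_mul_odd {q : ℂ} (hq : ‖q‖ < 1) (x : ℂ) :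
    qPochInf x (q ^ 2) * qPochInf (x * q) (q ^ 2) = qPochInf x q := by
  have hq2 : ‖q ^ 2‖ < 1 := by rw [norm_pow]; exact pow_lt_one₀ (norm_nonneg _) hq two_ne_zero
  have h0 : (fun n => qFactor x q (2 * n)) = qFactor x (q ^ 2) := by
    funext n; simp only [qFactor]; ring
  have h1 : (fun n => qFactor x q (2 * n + 1)) = qFactor (x * q) (q ^ 2) := by
    funext n; simp only [qFactor]; ring
  have := tprod_even_mul_odd (f := qFactor x q)
    (by rw [h0]; exact multipliable_qFactor hq2 _) (by rw [h1]; exact multipliable_qFactor hq2 _)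
  rwa [h0, h1] at this

lemma differentiable_qPochInf {q : ℂ} (hq : ‖q‖ < 1) : Differentiable ℂ fun x => qPochInf x q := by
  intro x
  have hs : Summable fun n : ℕ => (‖x‖ + 1) * ‖q‖ ^ n :=
    (summable_geometric_of_lt_one (norm_nonneg q) hq).mul_left _
  have h := hs.hasProdLocallyUniformlyOn_nat_one_add (f := fun (n : ℕ) (z : ℂ) => -(z * q ^ n))
    (K := Metric.ball 0 (‖x‖ + 1)) Metric.isOpen_ball
    (Eventually.of_forall fun n z hz => by
      rw [norm_neg, norm_mul, norm_pow]
      have : ‖z‖ ≤ ‖x‖ + 1 := by simpa using (mem_ball_zero_iff.mp hz).le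
      gcongr) (fun n => by fun_prop)
  have hd := h.differentiableOn
    (.of_forall fun _ ↦ by simpa [Finset.prod_fn] using
      DifferentiableOn.finsetProd (fun _ _ ↦ by fun_prop)) Metric.isOpen_ball
  have := hd.differentiableAt (Metric.isOpen_ball.mem_nhds (show x ∈ Metric.ball 0 (‖x‖ + 1) by simp))
  simpa [qPochInf, qFactor, sub_eq_add_neg] using this

/-! ### The theta product -/

/-- The product `(x; q)_∞ (q / x; q)_∞`. -/
noncomputable def thetaProd (x q : ℂ) : ℂ := qPochInf x q * qPochInf (q / x) q

lemma thetaProd_one {q : ℂ} (hq : ‖q‖ < 1) : thetaProd 1 q = 0 := by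
  simp [thetaProd, qPochInf_one hq]

lemma thetaProd_inv {q : ℂ} (hq : ‖q‖ < 1) {x : ℂ} (hx : x ≠ 0) :
    thetaProd x⁻¹ q = -thetaProd x q / x := by
  rw [thetaProd, thetaProd, qPochInf_eq_mul hq x⁻¹, qPochInf_eq_mul hq x, div_inv_eq_mul,
    mul_comm q x, inv_mul_eq_div]
  field_simp
  ring

lemma thetaProd_mul {q : ℂ} (hq : ‖q‖ < 1) (hq0 : q ≠ 0) {x : ℂ} (hx : x ≠ 0) :
    thetaProd (q * x) q = -thetaProd x q / x := by
  rw [← thetaProd_inv hq hx, thetaProd, thetaProd, div_inv_eq_mul, mul_comm (qPochInf x⁻¹ q)]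
  congr 2
  field_simp

lemma thetaProd_mul_neg {q r : ℂ} (hq : ‖q‖ < 1) (hr : r = q ∨ r = -q) (x : ℂ) :
    thetaProd x r * thetaProd (-x) r = thetaProd (x ^ 2) (q ^ 2) := by
  have h2 : r ^ 2 = q ^ 2 := by rcases hr with rfl | rfl <;> ring
  have h := qPochInf_mul_neg hq hr (r / x)
  rw [div_pow, h2] at h
  rw [thetaProd, thetaProd, thetaProd, ← qPochInf_mul_neg hq hr x, ← h, div_neg]
  ring

/-! ### The rank series multiplied by its denominators -/

lemma norm_pow_mul_qPochInf_mul_le {q : ℂ} (hq : ‖q‖ < 1) {e n : ℕ} (he : n ≤ e) {u v : ℂ}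
    {A B : ℝ} (hu : ‖u‖ ≤ A) (hv : ‖v‖ ≤ B) :
    ‖q ^ e * qPochInf u q * qPochInf v q‖ ≤
      ‖q‖ ^ n * (Real.exp (A * (1 - ‖q‖)⁻¹) * Real.exp (B * (1 - ‖q‖)⁻¹)) := by
  rw [norm_mul, norm_mul, norm_pow, mul_assoc]
  have h1 := norm_qPochInf_le_of_norm_le hq hu
  have h2 := norm_qPochInf_le_of_norm_le hq hv
  have h3 := pow_le_pow_of_le_one (norm_nonneg q) hq.le he
  gcongr

lemma summable_pow_norm_mul {q : ℂ} (hq : ‖q‖ < 1) (C : ℝ) :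
    Summable fun n : ℕ => ‖q‖ ^ n * C :=
  (summable_geometric_of_lt_one (norm_nonneg q) hq).mul_right C

lemma summable_pow_mul_qPochInf_mul {q : ℂ} (hq : ‖q‖ < 1) {e : ℕ → ℕ} (he : ∀ n, n ≤ e n)
    {u v : ℕ → ℂ} {A B : ℝ} (hu : ∀ n, ‖u n‖ ≤ A) (hv : ∀ n, ‖v n‖ ≤ B) :
    Summable fun n => q ^ e n * qPochInf (u n) q * qPochInf (v n) q :=
  (summable_pow_norm_mul hq _).of_norm_bounded fun n =>
    norm_pow_mul_qPochInf_mul_le hq (he n) (hu n) (hv n)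

lemma norm_mul_pow_le {q : ℂ} (hq : ‖q‖ < 1) (x : ℂ) (n : ℕ) : ‖x * q ^ n‖ ≤ ‖x‖ := by
  rw [norm_mul, norm_pow]
  exact mul_le_of_le_one_right (norm_nonneg _) (pow_le_one₀ (norm_nonneg _) hq.le)

lemma norm_pow_div_le {q : ℂ} (hq : ‖q‖ < 1) (x : ℂ) (n : ℕ) : ‖q ^ n / x‖ ≤ ‖x⁻¹‖ := by
  rw [div_eq_inv_mul]
  exact norm_mul_pow_le hq _ _

lemma le_sq_self (n : ℕ) : n ≤ n ^ 2 := Nat.le_self_pow two_ne_zero n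

/-- The `n`-th term `q ^ (n ^ 2) (x q ^ (n + 1); q)_∞ (q ^ (n + 1) / x; q)_∞`. -/
noncomputable def rankTerm (x q : ℂ) (n : ℕ) : ℂ :=
  q ^ (n ^ 2) * qPochInf (x * q ^ (n + 1)) q * qPochInf (q ^ (n + 1) / x) q

/-- The rank generating function in `x` and `q`, multiplied by `(x q; q)_∞ (q / x; q)_∞`. -/
noncomputable def rankSum (x q : ℂ) : ℂ := ∑' n, rankTerm x q n

/-- The universal mock theta function `g₃` in `x` and `q`, multiplied by
`(x; q)_∞ (q / x; q)_∞`. -/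
noncomputable def universalSum (x q : ℂ) : ℂ :=
  ∑' n : ℕ, q ^ (n * (n + 1)) * qPochInf (x * q ^ (n + 1)) q * qPochInf (q ^ (n + 2) / x) q

lemma summable_rankTerm {q : ℂ} (hq : ‖q‖ < 1) (x : ℂ) : Summable (rankTerm x q) :=
  summable_pow_mul_qPochInf_mul hq le_sq_self (fun n => norm_mul_pow_le hq x (n + 1))
    (fun n => norm_pow_div_le hq x (n + 1))

lemma rankSum_inv (x q : ℂ) : rankSum x⁻¹ q = rankSum x q := by
  refine tsum_congr fun n => ?_
  rw [rankTerm, rankTerm, div_inv_eq_mul, inv_mul_eq_div, mul_comm _ x]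
  ring

lemma universalSum_mul {q : ℂ} (hq0 : q ≠ 0) (x : ℂ) :
    universalSum (q * x) q = universalSum x⁻¹ q := by
  refine tsum_congr fun n => ?_
  have h1 : q * x * q ^ (n + 1) = q ^ (n + 2) / x⁻¹ := by rw [div_inv_eq_mul]; ring
  have h2 : q ^ (n + 2) / (q * x) = x⁻¹ * q ^ (n + 1) := by
    rw [pow_succ' q (n + 1), mul_div_mul_left _ _ hq0, div_eq_inv_mul]
  rw [h1, h2]
  ring

/-- Telescoping: the difference of the n-th terms of `rankSum` and of x times `universalSum` is T n
- T (n + 1), and T 0 is the theta product. -/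
lemma rankSum_eq_add {q : ℂ} (hq : ‖q‖ < 1) {x : ℂ} (hx : x ≠ 0) :
    rankSum x q = thetaProd x q + x * universalSum x q := by
  set T : ℕ → ℂ := fun n => q ^ (n ^ 2) * qPochInf (x * q ^ n) q * qPochInf (q ^ (n + 1) / x) q
    with hT
  have hTs : Summable T := summable_pow_mul_qPochInf_mul hq le_sq_self
    (fun n => norm_mul_pow_le hq x n) (fun n => norm_pow_div_le hq x (n + 1))
  have hU : Summable fun n : ℕ =>
      q ^ (n * (n + 1)) * qPochInf (x * q ^ (n + 1)) q * qPochInf (q ^ (n + 2) / x) q :=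
    summable_pow_mul_qPochInf_mul hq (fun n => Nat.le_mul_of_pos_right n n.succ_pos)
      (fun n => norm_mul_pow_le hq x (n + 1)) (fun n => norm_pow_div_le hq x (n + 2))
  have h0 : T 0 = thetaProd x q := by simp [hT, thetaProd]
  have h1 : rankSum x q - x * universalSum x q = T 0 := by
    rw [rankSum, universalSum, ← tsum_mul_left, ← (summable_rankTerm hq x).tsum_sub (hU.mul_left x)]
    have h2 : ∑' n, (T n - T (n + 1)) = T 0 := by
      rw [hTs.tsum_sub ((summable_nat_add_iff 1).mpr hTs), hTs.tsum_eq_zero_add]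
      ring
    rw [← h2]
    refine tsum_congr fun n => ?_
    have e1 := qPochInf_eq_mul hq (x * q ^ n)
    have e2 := qPochInf_eq_mul hq (q ^ (n + 1) / x)
    rw [show x * q ^ n * q = x * q ^ (n + 1) by ring] at e1
    rw [show q ^ (n + 1) / x * q = q ^ (n + 2) / x by ring] at e2
    simp only [hT, rankTerm]
    rw [e1, e2]
    field_simp
    ring
  rw [← h0, ← h1]
  ring

/-- The behaviour of the rank generating function under `x ↦ q x`. -/
lemma rankSum_mul {q : ℂ} (hq : ‖q‖ < 1) (hq0 : q ≠ 0) {x : ℂ} (hx : x ≠ 0) :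
    rankSum (q * x) q = q * x ^ 2 * rankSum x q - (x⁻¹ - q * x) * thetaProd x q := by
  -- `universalSum` takes the same value at qx and at x⁻¹, so it can be eliminated between the
  -- decompositions at these two points.
  have h1 := rankSum_eq_add hq (mul_ne_zero hq0 hx)
  have h2 := rankSum_eq_add hq (inv_ne_zero hx)
  rw [rankSum_inv, thetaProd_inv hq hx] at h2
  rw [h1, thetaProd_mul hq hq0 hx, universalSum_mul hq0, h2]
  field_simp
  ring

lemma norm_rankTerm_le {q : ℂ} (hq : ‖q‖ < 1) {x : ℂ} {A B : ℝ} (hA : ‖x‖ ≤ A) (hB : ‖x⁻¹‖ ≤ B)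
    (n : ℕ) : ‖rankTerm x q n‖ ≤
      ‖q‖ ^ n * (Real.exp (A * (1 - ‖q‖)⁻¹) * Real.exp (B * (1 - ‖q‖)⁻¹)) :=
  norm_pow_mul_qPochInf_mul_le hq (le_sq_self n) ((norm_mul_pow_le hq x (n + 1)).trans hA)
    ((norm_pow_div_le hq x (n + 1)).trans hB)

lemma differentiableAt_thetaProd {q : ℂ} (hq : ‖q‖ < 1) {x : ℂ} (hx : x ≠ 0) :
    DifferentiableAt ℂ (fun x => thetaProd x q) x := by
  have h := differentiable_qPochInf hq
  exact (h x).mul ((h _).comp x ((differentiableAt_const q).div differentiableAt_id hx))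

lemma differentiableAt_rankSum {q : ℂ} (hq : ‖q‖ < 1) {x : ℂ} (hx : x ≠ 0) :
    DifferentiableAt ℂ (fun x => rankSum x q) x := by
  have hU : IsOpen {z : ℂ | ‖z‖ < ‖x‖ + 1 ∧ ‖x‖ / 2 < ‖z‖} :=
    (isOpen_lt continuous_norm continuous_const).inter (isOpen_lt continuous_const continuous_norm)
  have hx' : 0 < ‖x‖ := norm_pos_iff.mpr hx
  have hne : ∀ z ∈ {z : ℂ | ‖z‖ < ‖x‖ + 1 ∧ ‖x‖ / 2 < ‖z‖}, z ≠ 0 := fun z hz =>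
    norm_pos_iff.mp (lt_trans (by positivity) hz.2)
  have h := differentiable_qPochInf hq
  have := Complex.differentiableOn_tsum_of_summable_norm
    (F := fun n z => rankTerm z q n) (summable_pow_norm_mul hq _)
    (fun n z hz => DifferentiableAt.differentiableWithinAt ?_) hU
    (fun n z hz => norm_rankTerm_le hq hz.1.le
      (B := (‖x‖ / 2)⁻¹) (by rw [norm_inv]; exact inv_anti₀ (by positivity) hz.2.le) n)
  · exact this.differentiableAt (hU.mem_nhds ⟨by simp, by simpa using hx⟩)
  · exact (((h _).comp z (differentiableAt_id.mul_const _)).const_mul _).mul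
      ((h _).comp z ((differentiableAt_const _).div differentiableAt_id (hne z hz)))

/-! ### The value at `x = 1` -/

/-- Consecutive differences have nondecreasing norm in k yet tend to 0, so they all vanish. -/
lemma tendsto_const_of_sub_eq_mul {u c : ℕ → ℂ} {l : ℂ} (hc : ∀ k, ‖c k‖ ≤ 1)
    (h : ∀ k, u k - u (k + 1) = c k * (u (k + 1) - u (k + 2))) (hu : Tendsto u atTop (𝓝 l)) :
    u 0 = l := by
  have hd : Tendsto (fun k => ‖u k - u (k + 1)‖) atTop (𝓝 0) := by
    simpa using (hu.sub ((tendsto_add_atTop_iff_nat 1).mpr hu)).norm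
  have hm : Monotone fun k => ‖u k - u (k + 1)‖ := monotone_nat_of_le_succ fun k => by
    rw [h k, norm_mul]
    exact mul_le_of_le_one_left (norm_nonneg _) (hc k)
  have h0 : ∀ k, u (k + 1) = u k := fun k => by
    have := norm_le_zero_iff.mp (hm.ge_of_tendsto hd k)
    exact (sub_eq_zero.mp this).symm
  have hconst : ∀ k, u k = u 0 := fun k => by
    induction k with
    | zero => rfl
    | succ k ih => rw [h0, ih]
  exact tendsto_nhds_unique (tendsto_const_nhds.congr fun k => (hconst k).symm) hu

/-- Cauchy's identity `∑ q ^ (n ^ 2) / (q; q)_n ^ 2 = 1 / (q; q)_∞`, with denominators cleared. -/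
lemma rankSum_one {q : ℂ} (hq : ‖q‖ < 1) : rankSum 1 q = qPochInf q q := by
  -- Cauchy's sum is embedded in a family indexed by k, with q^(n² + kn) and one product shifted by
  -- k. The sums turn out not to depend on k, and k → ∞ is easy.
  set t : ℕ → ℕ → ℂ := fun k n =>
    q ^ (n ^ 2 + k * n) * qPochInf (1 * q ^ (k + n + 1)) q * qPochInf (1 * q ^ (n + 1)) q with ht
  have hts : ∀ k, Summable (t k) := fun k => summable_pow_mul_qPochInf_mul hq
    (fun n => (le_sq_self n).trans (Nat.le_add_right _ _))
    (fun n => norm_mul_pow_le hq 1 (k + n + 1)) (fun n => norm_mul_pow_le hq 1 (n + 1))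
  have h0 : rankSum 1 q = ∑' n, t 0 n := tsum_congr fun n => by simp [rankTerm, ht]
  rw [h0]
  refine tendsto_const_of_sub_eq_mul (u := fun k => ∑' n, t k n) (c := fun k => -q ^ (k + 1))
    (fun k => ?_) (fun k => ?_) ?_
  · rw [norm_neg, norm_pow]
    exact pow_le_one₀ (norm_nonneg _) hq.le
  · set A : ℕ → ℂ := fun n => q ^ (n ^ 2 + k * n) * qPochInf (1 * q ^ (k + n + 2)) q *
      qPochInf (1 * q ^ n) q with hA
    set B : ℕ → ℂ := fun n => q ^ (n ^ 2 + k * n + (k + n + 1)) * qPochInf (1 * q ^ (k + n + 2)) q *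
      qPochInf (1 * q ^ (n + 1)) q with hB
    have hAs : Summable A := summable_pow_mul_qPochInf_mul hq
      (fun n => (le_sq_self n).trans (Nat.le_add_right _ _))
      (fun n => norm_mul_pow_le hq 1 (k + n + 2)) (fun n => norm_mul_pow_le hq 1 n)
    have hBs : Summable B := summable_pow_mul_qPochInf_mul hq
      (fun n => by omega)
      (fun n => norm_mul_pow_le hq 1 (k + n + 2)) (fun n => norm_mul_pow_le hq 1 (n + 1))
    -- Since (1; q)_∞ = 0, the sum of A may be reindexed from n + 1, which matches it with B.
    have hA0 : A 0 = 0 := by simp [hA, qPochInf_one hq]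
    have e (m : ℕ) : qPochInf (1 * q ^ m) q = (1 - q ^ m) * qPochInf (1 * q ^ (m + 1)) q := by
      rw [qPochInf_eq_mul hq (1 * q ^ m), show 1 * q ^ m * q = 1 * q ^ (m + 1) by ring]
      ring
    calc ∑' n, t k n - ∑' n, t (k + 1) n = ∑' n, (t k n - t (k + 1) n) :=
          ((hts k).tsum_sub (hts (k + 1))).symm
      _ = ∑' n, (A n - B n) := tsum_congr fun n => by
          simp only [ht, hA, hB]
          rw [e (k + n + 1), e n, show k + 1 + n + 1 = k + n + 2 by ring,
            show k + n + 1 + 1 = k + n + 2 by ring]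
          ring
      _ = ∑' n, (A (n + 1) - B n) := by
          rw [hAs.tsum_sub hBs, hAs.tsum_eq_zero_add, hA0, zero_add,
            ((summable_nat_add_iff 1).mpr hAs).tsum_sub hBs]
      _ = ∑' n, -q ^ (k + 1) * (t (k + 1) n - t (k + 2) n) := tsum_congr fun n => by
          simp only [ht, hA, hB]
          rw [show k + 1 + n + 1 = k + n + 2 by ring, show k + (n + 1) + 2 = k + n + 3 by ring,
            show k + 2 + n + 1 = k + n + 3 by ring, e (k + n + 2)]
          ring
      _ = _ := by rw [tsum_mul_left, (hts (k + 1)).tsum_sub (hts (k + 2))]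
  · have hlim : ∑' n : ℕ, (if n = 0 then qPochInf q q else 0) = qPochInf q q := by
      simp
    rw [← hlim]
    refine tendsto_tsum_of_dominated_convergence (summable_pow_norm_mul hq _) (fun n => ?_)
      (Eventually.of_forall fun k n => norm_pow_mul_qPochInf_mul_le hq
        ((le_sq_self n).trans (Nat.le_add_right _ _))
        (norm_mul_pow_le hq 1 (k + n + 1)) (norm_mul_pow_le hq 1 (n + 1)))
    have hp := tendsto_pow_atTop_nhds_zero_of_norm_lt_one hq
    have hP : Tendsto (fun k => qPochInf (1 * q ^ (k + n + 1)) q) atTop (𝓝 1) := by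
      have h1 : Tendsto (fun k : ℕ => 1 * q ^ (k + n + 1)) atTop (𝓝 0) := by
        simpa [add_assoc] using (tendsto_add_atTop_iff_nat (n + 1)).mpr hp
      have h2 := ((differentiable_qPochInf hq).continuous.tendsto 0).comp h1
      rwa [qPochInf_zero] at h2
    rcases Nat.eq_zero_or_pos n with rfl | hn
    · simpa [ht] using hP.mul_const (qPochInf q q)
    · have hz : Tendsto (fun k : ℕ => q ^ (n ^ 2 + k * n)) atTop (𝓝 0) := by
        have : Tendsto (fun k : ℕ => n ^ 2 + k * n) atTop atTop :=
          tendsto_atTop_mono (fun k => (Nat.le_mul_of_pos_right k hn).trans (Nat.le_add_left _ _))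
            tendsto_id
        exact hp.comp this
      simpa [ht, hn.ne'] using (hz.mul hP).mul_const (qPochInf (1 * q ^ (n + 1)) q)

/-! ### Combining three rank series -/

/-- A holomorphic function on `ℂ \ {0}` invariant under `y ↦ q y` is constant. -/
lemma eq_apply_one_of_apply_mul_eq {F : ℂ → ℂ} {q : ℂ} (hq : ‖q‖ < 1) (hq0 : q ≠ 0)
    (hF : ∀ y ≠ 0, DifferentiableAt ℂ F y) (h : ∀ y ≠ 0, F (q * y) = F y) {y : ℂ} (hy : y ≠ 0) :
    F y = F 1 := by
  have hq' : 0 < ‖q‖ := norm_pos_iff.mpr hq0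
  have hz : ∀ (n : ℤ) (y : ℂ), y ≠ 0 → F (q ^ n * y) = F y := by
    intro n
    induction n with
    | zero => simp
    | succ n ih =>
      intro y hy
      rw [zpow_add_one₀ hq0, mul_assoc, ih _ (mul_ne_zero hq0 hy), h y hy]
    | pred n ih =>
      intro y hy
      have := h _ (mul_ne_zero (zpow_ne_zero (-(n : ℤ) - 1) hq0) hy)
      rw [← this, ← mul_assoc, ← zpow_one_add₀ hq0, add_sub_cancel, ih y hy]
  -- A compact annulus meeting every orbit of multiplication by q; it bounds F on ℂ \ {0}, and
  -- composing with exp gives a bounded entire function.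
  set K : Set ℂ := {z | ‖q‖ ≤ ‖z‖ ∧ ‖z‖ ≤ 1} with hK
  have hKc : IsCompact K := by
    refine (isCompact_closedBall (0 : ℂ) 1).of_isClosed_subset ?_
      (fun z hz => mem_closedBall_zero_iff.mpr hz.2)
    exact (isClosed_le continuous_const continuous_norm).inter
      (isClosed_le continuous_norm continuous_const)
  have hKF : ContinuousOn F K := fun z hz =>
    (hF z (norm_pos_iff.mp (hq'.trans_le hz.1))).continuousAt.continuousWithinAt
  have hmem : ∀ z ≠ 0, F z ∈ F '' K := by
    intro z hz0
    obtain ⟨n, hn1, hn2⟩ := exists_mem_Ioc_zpow (norm_pos_iff.mpr hz0) ((one_lt_inv₀ hq').mpr hq)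
    refine ⟨q ^ (n + 1) * z, ⟨?_, ?_⟩, hz _ z hz0⟩
    · rw [norm_mul, norm_zpow, zpow_add_one₀ hq'.ne']
      have : 1 ≤ ‖q‖ ^ n * ‖z‖ := by
        rw [inv_zpow] at hn1
        have := (inv_lt_iff_one_lt_mul₀' (zpow_pos hq' n)).mp hn1
        exact this.le
      nlinarith
    · rw [norm_mul, norm_zpow]
      rw [inv_zpow] at hn2
      exact (le_inv_mul_iff₀ (zpow_pos hq' _)).mp (by simpa using hn2)
  have hd : Differentiable ℂ fun w => F (Complex.exp w) := fun w =>
    (hF _ (Complex.exp_ne_zero w)).comp w Complex.differentiable_exp.differentiableAt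
  have hb : Bornology.IsBounded (Set.range fun w => F (Complex.exp w)) := by
    refine (hKc.image_of_continuousOn hKF).isBounded.subset ?_
    rintro _ ⟨w, rfl⟩
    exact hmem _ (Complex.exp_ne_zero w)
  have := hd.apply_eq_apply_of_bounded hb (Complex.log y) 0
  simpa [Complex.exp_log hy] using this

open Complex in
/-- The combination of three rank series underlying the identity, with denominators cleared. -/
noncomputable def rankCombination (q y : ℂ) : ℂ :=
  (1 + I) / 2 * (thetaProd y q * thetaProd (-I * y) (-q) * rankSum (I * y) (-q)) +
    (1 - I) / 2 * (thetaProd y q * thetaProd (I * y) (-q) * rankSum (-I * y) (-q)) -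
    thetaProd (I * y) (-q) * thetaProd (-I * y) (-q) * rankSum y q

-- The map y ↦ qy exchanges the points ±iy up to a factor -q, so the first two terms swap. The
-- weights (1 ± i)/2 are forced: their ratio makes the swap consistent, and their sum 1 cancels the
-- inhomogeneous multiples of the triple theta product.
open Complex in
lemma rankCombination_mul {q : ℂ} (hq : ‖q‖ < 1) (hq0 : q ≠ 0) {y : ℂ} (hy : y ≠ 0) :
    rankCombination q (q * y) = q * rankCombination q y := by
  have hn : ‖-q‖ < 1 := by rwa [norm_neg]
  have hn0 : -q ≠ 0 := neg_ne_zero.mpr hq0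
  have hp : I * y ≠ 0 := mul_ne_zero I_ne_zero hy
  have hm : -I * y ≠ 0 := mul_ne_zero (neg_ne_zero.mpr I_ne_zero) hy
  have ip : (I * y)⁻¹ = -I * y⁻¹ := by rw [mul_inv, inv_I]
  have im : (-I * y)⁻¹ = I * y⁻¹ := by rw [mul_inv, inv_neg, inv_I, neg_neg]
  have ep : I * (q * y) = -q * (-I * y) := by ring
  have em : -I * (q * y) = -q * (I * y) := by ring
  have t0 := thetaProd_mul hq hq0 hy
  have tp := thetaProd_mul hn hn0 hm
  have tm := thetaProd_mul hn hn0 hp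
  have s0 := rankSum_mul hq hq0 hy
  have sp := rankSum_mul hn hn0 hm
  have sm := rankSum_mul hn hn0 hp
  rw [div_eq_mul_inv] at t0 tp tm
  rw [im] at tp sp
  rw [ip] at tm sm
  rw [rankCombination, rankCombination, ep, em, t0, tp, tm, s0, sp, sm]
  generalize thetaProd y q = a
  generalize thetaProd (I * y) (-q) = b
  generalize thetaProd (-I * y) (-q) = c
  generalize rankSum y q = u
  generalize rankSum (I * y) (-q) = v
  generalize rankSum (-I * y) (-q) = w
  have hI : I ^ 2 = -1 := I_sq
  have hI3 : I ^ 3 = -I := I_pow_three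
  have hI4 : I ^ 4 = 1 := I_pow_four
  field_simp
  ring_nf
  simp only [hI, hI3, hI4]
  ring

lemma differentiableAt_rankCombination {q : ℂ} (hq : ‖q‖ < 1) {y : ℂ} (hy : y ≠ 0) :
    DifferentiableAt ℂ (rankCombination q) y := by
  have hn : ‖-q‖ < 1 := by rwa [norm_neg]
  have hp : Complex.I * y ≠ 0 := mul_ne_zero Complex.I_ne_zero hy
  have hm : -Complex.I * y ≠ 0 := mul_ne_zero (neg_ne_zero.mpr Complex.I_ne_zero) hy
  have t0 := differentiableAt_thetaProd hq hy
  have s0 := differentiableAt_rankSum hq hy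
  have tp : DifferentiableAt ℂ (fun y => thetaProd (Complex.I * y) (-q)) y :=
    (differentiableAt_thetaProd hn hp).comp y (differentiableAt_id.const_mul _)
  have tm : DifferentiableAt ℂ (fun y => thetaProd (-Complex.I * y) (-q)) y :=
    (differentiableAt_thetaProd hn hm).comp y (differentiableAt_id.const_mul _)
  have sp : DifferentiableAt ℂ (fun y => rankSum (Complex.I * y) (-q)) y :=
    (differentiableAt_rankSum hn hp).comp y (differentiableAt_id.const_mul _)
  have sm : DifferentiableAt ℂ (fun y => rankSum (-Complex.I * y) (-q)) y :=
    (differentiableAt_rankSum hn hm).comp y (differentiableAt_id.const_mul _)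
  exact ((((t0.mul tm).mul sp).const_mul _).add (((t0.mul tp).mul sm).const_mul _)).sub
    ((tp.mul tm).mul s0)

lemma rankCombination_one {q : ℂ} (hq : ‖q‖ < 1) :
    rankCombination q 1 = -(thetaProd (-1) (q ^ 2) * qPochInf q q) := by
  have h := thetaProd_mul_neg hq (Or.inr rfl) Complex.I
  rw [Complex.I_sq] at h
  rw [rankCombination, thetaProd_one hq, rankSum_one hq, ← h]
  simp

lemma rankCombination_eq {q : ℂ} (hq : ‖q‖ < 1) (hq0 : q ≠ 0) {y : ℂ} (hy : y ≠ 0) :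
    rankCombination q y = -(thetaProd (-1) (q ^ 2) * qPochInf q q) * y := by
  have h := eq_apply_one_of_apply_mul_eq (F := fun y => rankCombination q y / y) hq hq0
    (fun y hy => (differentiableAt_rankCombination hq hy).div differentiableAt_id hy)
    (fun y hy => by
      simp only [rankCombination_mul hq hq0 hy]
      rw [mul_div_mul_left _ _ hq0]) hy
  simp only [div_one, rankCombination_one hq] at h
  rw [← h, div_mul_cancel₀ _ hy]

/-! ### The series `f_c` as quotients -/

/-- The product `(x q; q)_∞ (q / x; q)_∞`. -/
noncomputable def rankDenom (x q : ℂ) : ℂ := qPochInf (x * q) q * qPochInf (x⁻¹ * q) q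

lemma thetaProd_eq_mul_rankDenom {q : ℂ} (hq : ‖q‖ < 1) (x : ℂ) :
    thetaProd x q = (1 - x) * rankDenom x q := by
  rw [thetaProd, rankDenom, qPochInf_eq_mul hq x, div_eq_inv_mul, mul_assoc]

lemma rankDenom_mul_neg {q r : ℂ} (hq : ‖q‖ < 1) (hr : r = q ∨ r = -q) (x : ℂ) :
    rankDenom x r * rankDenom (-x) r = rankDenom (x ^ 2) (q ^ 2) := by
  have h2 : r ^ 2 = q ^ 2 := by rcases hr with rfl | rfl <;> ring
  have h1 := qPochInf_mul_neg hq hr (x * r)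
  have h3 := qPochInf_mul_neg hq hr (x⁻¹ * r)
  rw [mul_pow, h2] at h1 h3
  rw [rankDenom, rankDenom, rankDenom, ← inv_pow, ← h1, ← h3, inv_neg, neg_mul, neg_mul]
  ring

lemma one_sub_ne_zero_of_norm_lt_one {z : ℂ} (hz : ‖z‖ < 1) : 1 - z ≠ 0 := by
  intro h
  rw [← sub_eq_zero.mp h] at hz
  simp at hz

lemma norm_mul_lt_one {x q : ℂ} (hx : ‖x‖ = 1) (hq : ‖q‖ < 1) : ‖x * q‖ < 1 := by
  rwa [norm_mul, hx, one_mul]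

lemma norm_pow_lt_one {q : ℂ} (hq : ‖q‖ < 1) {n : ℕ} (hn : 1 ≤ n) : ‖q ^ n‖ < 1 := by
  rw [norm_pow]
  exact pow_lt_one₀ (norm_nonneg _) hq (by omega)

lemma rankDenom_ne_zero {x q : ℂ} (hx : ‖x‖ = 1) (hq : ‖q‖ < 1) : rankDenom x q ≠ 0 :=
  mul_ne_zero (qPochInf_ne_zero_of_norm_lt_one hq (norm_mul_lt_one hx hq))
    (qPochInf_ne_zero_of_norm_lt_one hq (norm_mul_lt_one (by simp [hx]) hq))

lemma quadFactor_eq_mul {c : ℝ} {x : ℂ} (hx : x ≠ 0) (hc : (c : ℂ) = -(x + x⁻¹)) (q : ℂ) (k : ℕ) :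
    quadFactor c q k = (1 - x * q ^ k) * (1 - x⁻¹ * q ^ k) := by
  rw [quadFactor, hc]
  linear_combination (-(q ^ (2 * k))) * mul_inv_cancel₀ hx

lemma quadFactor_ne_zero {c : ℝ} {x q : ℂ} (hx : ‖x‖ = 1) (hc : (c : ℂ) = -(x + x⁻¹))
    (hq : ‖q‖ < 1) {k : ℕ} (hk : 1 ≤ k) : quadFactor c q k ≠ 0 := by
  rw [quadFactor_eq_mul (norm_ne_zero_iff.mp (by simp [hx])) hc]
  have h := norm_pow_lt_one hq hk
  exact mul_ne_zero (one_sub_ne_zero_of_norm_lt_one (norm_mul_lt_one hx h))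
    (one_sub_ne_zero_of_norm_lt_one (norm_mul_lt_one (by simp [hx]) h))

lemma mockTerm_eq_div {c : ℝ} {x q : ℂ} (hx : ‖x‖ = 1) (hc : (c : ℂ) = -(x + x⁻¹))
    (hq : ‖q‖ < 1) (n : ℕ) : mockTerm c q n = rankTerm x q n / rankDenom x q := by
  have hx0 : x ≠ 0 := norm_ne_zero_iff.mp (by simp [hx])
  have hprod : ∏ k ∈ Finset.Icc 1 n, quadFactor c q k ≠ 0 :=
    Finset.prod_ne_zero_iff.mpr fun k hk => quadFactor_ne_zero hx hc hq (Finset.mem_Icc.mp hk).1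
  rw [mockTerm, div_eq_div_iff hprod (rankDenom_ne_zero hx hq), rankDenom, rankTerm,
    qPochInf_eq_prod_mul hq x n, qPochInf_eq_prod_mul hq x⁻¹ n, div_eq_inv_mul,
    Finset.prod_congr rfl fun k _ => quadFactor_eq_mul hx0 hc q k, Finset.prod_mul_distrib]
  ring

lemma summable_mockTerm {c : ℝ} {x q : ℂ} (hx : ‖x‖ = 1) (hc : (c : ℂ) = -(x + x⁻¹))
    (hq : ‖q‖ < 1) : Summable (mockTerm c q) :=
  ((summable_rankTerm hq x).div_const (rankDenom x q)).congr fun n => (mockTerm_eq_div hx hc hq n).symm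

lemma mockF_eq_div {c : ℝ} {x q : ℂ} (hx : ‖x‖ = 1) (hc : (c : ℂ) = -(x + x⁻¹))
    (hq : ‖q‖ < 1) : mockF c q = rankSum x q / rankDenom x q := by
  rw [mockF, rankSum, ← tsum_div_const]
  exact tsum_congr fun n => mockTerm_eq_div hx hc hq n

lemma mockF_zero (c : ℝ) : mockF c 0 = 1 := by
  rw [mockF, tsum_eq_single 0 fun n hn => by simp [mockTerm, hn]]
  simp [mockTerm]

/-! ### The product on the right-hand side -/

lemma entryFactor_denom_eq {a b : ℝ} {y : ℂ} (hy : y ≠ 0) (hb : (b : ℂ) = -(y + y⁻¹))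
    (ha : (a : ℂ) = Complex.I * (y - y⁻¹)) (q : ℂ) (n : ℕ) :
    1 + ((a : ℂ) ^ 2 * (b : ℂ) ^ 2 - 2) * q ^ (4 * n) + q ^ (8 * n) =
      (1 - y ^ 4 * (q ^ 4) ^ n) * (1 - (y ^ 4)⁻¹ * (q ^ 4) ^ n) := by
  -- Here ab = -i(y² - y⁻²), so a²b² = 2 - y⁴ - y⁻⁴.
  have h : (a : ℂ) ^ 2 * (b : ℂ) ^ 2 - 2 = -(y ^ 4 + (y ^ 4)⁻¹) := by
    rw [ha, hb, mul_pow, Complex.I_sq]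
    field_simp
    ring
  rw [h, ← pow_mul, show 8 * n = 4 * n + 4 * n by ring, pow_add]
  linear_combination (-(q ^ (4 * n) * q ^ (4 * n))) * mul_inv_cancel₀ (pow_ne_zero 4 hy)

lemma hasProd_entryFactor {a b : ℝ} {y q : ℂ} (hy : ‖y‖ = 1) (hb : (b : ℂ) = -(y + y⁻¹))
    (ha : (a : ℂ) = Complex.I * (y - y⁻¹)) (hq : ‖q‖ < 1) :
    HasProd (fun n : ℕ => entryFactor a b q (n + 1))
      (rankDenom (-y) q / rankDenom (y ^ 4) (q ^ 4)) := by
  have hy0 : y ≠ 0 := norm_ne_zero_iff.mp (by simp [hy])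
  have hq4 : ‖q ^ 4‖ < 1 := norm_pow_lt_one hq (by norm_num)
  have hy4 : ‖y ^ 4‖ = 1 := by simp [hy]
  have h (x : ℂ) {r : ℂ} (hr : ‖r‖ < 1) :
      HasProd (fun n => qFactor (x * r) r n * qFactor (x⁻¹ * r) r n) (rankDenom x r) :=
    (multipliable_qFactor hr _).hasProd.mul (multipliable_qFactor hr _).hasProd
  refine ((h (-y) hq).div₀ (h (y ^ 4) hq4) (rankDenom_ne_zero hy4 hq4)).congr_fun fun n => ?_
  rw [entryFactor, entryFactor_denom_eq hy0 hb ha, hb]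
  simp only [qFactor]
  congr 1
  · rw [inv_neg]
    linear_combination (-(q ^ (2 * (n + 1)))) * mul_inv_cancel₀ hy0
  · ring

theorem mainTheorem1 (a b : ℝ) (hab : a ^ 2 + b ^ 2 = 4) (q : ℂ) (hq : ‖q‖ < 1) :
    -- no denominator vanishes
    ((∀ n : ℕ, 1 ≤ n →
        quadFactor a (-q) n ≠ 0 ∧ quadFactor (-a) (-q) n ≠ 0 ∧ quadFactor b q n ≠ 0 ∧
        1 + ((a : ℂ) ^ 2 * (b : ℂ) ^ 2 - 2) * q ^ (4 * n) + q ^ (8 * n) ≠ 0) ∧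
      qPochInf (-q) (q ^ 2) ≠ 0) ∧
    -- the series and the products converge
    (Summable (mockTerm a (-q)) ∧ Summable (mockTerm (-a) (-q)) ∧ Summable (mockTerm b q)) ∧
    (Multipliable (qFactor (q ^ 4) (q ^ 4)) ∧ Multipliable (qFactor (-q) (q ^ 2)) ∧
      Multipliable (fun n : ℕ => entryFactor a b q (n + 1))) ∧
    -- the identity
    ((b : ℂ) - a + 2) / 4 * mockF a (-q) + ((b : ℂ) + a + 2) / 4 * mockF (-a) (-q)
        - (b : ℂ) / 2 * mockF b q
      = qPochInf (q ^ 4) (q ^ 4) / qPochInf (-q) (q ^ 2)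
        * ∏' n : ℕ, entryFactor a b q (n + 1) := by
  have hI : Complex.I ^ 2 = -1 := Complex.I_sq
  have habc : (a : ℂ) ^ 2 + (b : ℂ) ^ 2 = 4 := by exact_mod_cast congrArg ((↑) : ℝ → ℂ) hab
  obtain ⟨y, hy_def⟩ : ∃ y : ℂ, y = -(b + Complex.I * a) / 2 := ⟨_, rfl⟩
  have hyinv : y⁻¹ = -(b - Complex.I * a) / 2 := by
    refine inv_eq_of_mul_eq_one_right ?_
    rw [hy_def]
    linear_combination (1 / 4) * habc - (a : ℂ) ^ 2 / 4 * hI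
  have hy : ‖y‖ = 1 := by
    have h1 : Complex.normSq y = 1 := by
      rw [hy_def, Complex.normSq_apply]
      simp
      linarith
    rw [Complex.norm_def, h1, Real.sqrt_one]
  have hy0 : y ≠ 0 := norm_ne_zero_iff.mp (by simp [hy])
  have hb : (b : ℂ) = -(y + y⁻¹) := by rw [hyinv, hy_def]; ring
  have ha : (a : ℂ) = Complex.I * (y - y⁻¹) := by
    rw [hyinv, hy_def]; linear_combination (a : ℂ) * hI
  have hp : ‖Complex.I * y‖ = 1 := by simp [hy]
  have hm : ‖-Complex.I * y‖ = 1 := by simp [hy]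
  have ham : (a : ℂ) = -(-Complex.I * y + (-Complex.I * y)⁻¹) := by
    rw [ha, mul_inv, inv_neg, Complex.inv_I]; ring
  have hap : ((-a : ℝ) : ℂ) = -(Complex.I * y + (Complex.I * y)⁻¹) := by
    push_cast
    rw [ha, mul_inv, Complex.inv_I]; ring
  have hn : ‖-q‖ < 1 := by rwa [norm_neg]
  have hq2 : ‖q ^ 2‖ < 1 := norm_pow_lt_one hq (by norm_num)
  have hq4 : ‖q ^ 4‖ < 1 := norm_pow_lt_one hq (by norm_num)
  have hy4 : ‖y ^ 4‖ = 1 := by simp [hy]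
  have hD : qPochInf (-q) (q ^ 2) ≠ 0 := qPochInf_ne_zero_of_norm_lt_one hq2 hn
  have hE := hasProd_entryFactor hy hb ha hq
  refine ⟨⟨fun n hn1 => ⟨quadFactor_ne_zero hm ham hn hn1, quadFactor_ne_zero hp hap hn hn1,
    quadFactor_ne_zero hy hb hq hn1, ?_⟩, hD⟩, ⟨summable_mockTerm hm ham hn,
    summable_mockTerm hp hap hn, summable_mockTerm hy hb hq⟩, ⟨multipliable_qFactor hq4 _,
    multipliable_qFactor hq2 _, hE.multipliable⟩, ?_⟩
  · rw [entryFactor_denom_eq hy0 hb ha]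
    have h := norm_pow_lt_one hq4 hn1
    exact mul_ne_zero (one_sub_ne_zero_of_norm_lt_one (norm_mul_lt_one hy4 h))
      (one_sub_ne_zero_of_norm_lt_one (norm_mul_lt_one (by simp [hy]) h))
  -- Invariance under y ↦ qy says nothing useful at q = 0; there every series equals 1.
  rcases eq_or_ne q 0 with rfl | hq0
  · simp only [neg_zero, mockF_zero]
    simp [qPochInf_zero, entryFactor]
    ring
  rw [hE.tprod_eq, mockF_eq_div hm ham hn, mockF_eq_div hp hap hn, mockF_eq_div hy hb hq]
  have key := rankCombination_eq hq hq0 hy0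
  rw [rankCombination, thetaProd_eq_mul_rankDenom hq, thetaProd_eq_mul_rankDenom hn,
    thetaProd_eq_mul_rankDenom hn, thetaProd_eq_mul_rankDenom hq2] at key
  -- The denominators at ±y (base q) and ±iy (base -q) multiply to the one at y⁴ in base q⁴.
  have d1 := rankDenom_mul_neg hq (Or.inl rfl) y
  have d2 := rankDenom_mul_neg hq (Or.inr rfl) (Complex.I * y)
  have d3 := rankDenom_mul_neg hq2 (Or.inl rfl) (y ^ 2)
  rw [← neg_mul, mul_pow, hI, neg_one_mul] at d2
  rw [← pow_mul, ← pow_mul, ← d1, ← d2] at d3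
  norm_num only at d3
  -- These yield (q⁴; q⁴) = (q; q)(-q; q²)(-q²; q²)².
  have e1 := qPochInf_mul_neg hq2 (Or.inl rfl) (q ^ 2)
  have e2 := qPochInf_mul_neg hq (Or.inl rfl) q
  have e3 := qPochInf_even_mul_odd hq (-q)
  rw [← pow_mul, ← e2, ← e3, neg_mul, ← pow_two] at e1
  norm_num only at e1
  have e4 : rankDenom (-1) (q ^ 2) = qPochInf (-q ^ 2) (q ^ 2) ^ 2 := by
    rw [rankDenom, inv_neg, inv_one, neg_one_mul, pow_two (qPochInf _ _)]
  rw [e4] at key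
  rw [← d3, ← e1]
  have n0 := rankDenom_ne_zero hy hq
  have n1 := rankDenom_ne_zero hp hn
  have n2 := rankDenom_ne_zero hm hn
  have n3 := rankDenom_ne_zero (x := -y) (by simp [hy]) hq
  rw [ha, hb]
  generalize rankDenom y q = φ at *
  generalize rankDenom (Complex.I * y) (-q) = φp at *
  generalize rankDenom (-Complex.I * y) (-q) = φm at *
  generalize rankDenom (-y) q = ψ at *
  generalize rankSum y q = s at *
  generalize rankSum (Complex.I * y) (-q) = sp at *
  generalize rankSum (-Complex.I * y) (-q) = sm at *
  generalize qPochInf (-q) (q ^ 2) = D at *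
  generalize qPochInf (-q ^ 2) (q ^ 2) = E at *
  generalize qPochInf q q = Q at *
  have rhs : Q * (D * E) * E / D * (ψ / (φ * ψ * (φp * φm))) = E ^ 2 * Q / (φ * φp * φm) := by
    field_simp
  rw [rhs, eq_div_iff (mul_ne_zero (mul_ne_zero n0 n1) n2)]
  -- The coefficients are those of `rankCombination` times -1/(2y), the factors 1 - x coming from
  -- `thetaProd_eq_mul_rankDenom`.
  have c1 : (-(y + y⁻¹) - Complex.I * (y - y⁻¹) + 2) / 4 =
      -((1 - Complex.I) / 2 * (1 - y) * (1 - Complex.I * y)) / (2 * y) := by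
    field_simp
    linear_combination (4 * y * (1 - y)) * hI
  have c2 : (-(y + y⁻¹) + Complex.I * (y - y⁻¹) + 2) / 4 =
      -((1 + Complex.I) / 2 * (1 - y) * (1 - -Complex.I * y)) / (2 * y) := by
    field_simp
    linear_combination (4 * y * (1 - y)) * hI
  have c3 : -(y + y⁻¹) / 2 = -((1 - Complex.I * y) * (1 - -Complex.I * y)) / (2 * y) := by
    field_simp
    linear_combination (-y ^ 2) * hI
  rw [c1, c2, c3]
  have h : E ^ 2 * Q = -(-((1 - -1) * E ^ 2 * Q) * y) / (2 * y) := by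
    field_simp
    ring
  rw [h, ← key]
  field_simp
  ring
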